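/- Let $p,q\ge 0$ be integers, let $\omega\in\mathbb R$ and let $\omega_{1-},\dots,\omega_{q-}$, $\alpha_{1+},\dots,\alpha_{q+}$, $\alpha_{1-},\dots,\alpha_{q-}$, $\beta_1,\dots,\beta_p$ be real numbers (of any sign). Let $(\eta_t)_{t\in\mathbb Z}$ be independent and identically distributed real random variables, on some probability space, with $E\eta_0^2=1$. A solution of the AS-Log-GARCH$(p,q)$ model is a process $(\epsilon_t)_{t\in\mathbb Z}$ on this space, together with a volatility process $(\sigma_t)_{t\in\mathbb Z}$, such that almost surely, for all $t\in\mathbb Z$, $\sigma_t>0$ and $$\epsilon_t=\sigma_t\eta_t,\qquad \log\sigma_t^2=\omega+\sum_{i=1}^q\omega_{i-}1_{\{\epsilon_{t-i}<0\}}+\sum_{j=1}^p\beta_j\log\sigma_{t-j}^2+\sum_{i=1}^q\left(\alpha_{i+}1_{\{\epsilon_{t-i}>0\}}+\alpha_{i-}1_{\{\epsilon_{t-i}<0\}}\right)\log\epsilon_{t-i}^2 .$$ Let $r=(\alpha_{1+},\dots,\alpha_{q+},\alpha_{1-},\dots,\alpha_{q-},\beta_1,\dots,\beta_p)$, and let $C_t$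 be the $(2q+p)\times(2q+p)$ random matrix, with rows and columns split into blocks of sizes $q,q,p$, in which the first row of the first, second and third block of rows is $1_{\{\eta_t>0\}}r$, $1_{\{\eta_t<0\}}r$ and $r$, respectively, and in which, for $i\ge2$, the $i$-th row of each block of rows has a $1$ in column $i-1$ of the block of columns with the same number and zeros elsewhere. Let $$\gamma(\mathbf C)=\inf_{t\ge1}\frac1t\,E\log\|C_tC_{t-1}\cdots C_1\|\in[-\infty,\infty)$$ be the top Lyapunov exponent of $\mathbf C=(C_t)_{t\in\mathbb Z}$, where $\log 0=-\infty$ and $\|\cdot\|$ is the matrix norm induced by the sup norm. Assume that $E\log^+|\log\eta_0^2|<\infty$ (with $\log 0=-\infty$, so that in particular $P(\eta_0=0)=0$) and that $\gamma(\mathbf C)<0$. Then: 1. The model has a strictly stationary solution; more precisely, it has one for which $(\epsilon_t,\sigma_t)_{t\in\mathbb Z}$ is strictly stationary. 2. The strictly stationary solution is unique: if $(\epsilon_t)$ and $(\epsilon'_t)$ are strictly stationary solutions with volatilities $(\sigma_t)$ and $(\sigma'_t)$, then $\epsilon_t=\epsilon'_t$ and $\sigma_t=\sigma'_t$ almost surely,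 for every $t\in\mathbb Z$. 3. The strictly stationary solution is non-anticipative (for every $t$, $\epsilon_t$ is almost surely a measurable function of $\eta_t,\eta_{t-1},\dots$, and $\sigma_t$ of $\eta_{t-1},\eta_{t-2},\dots$), and the process $(\epsilon_t,\sigma_t)_{t\in\mathbb Z}$ is ergodic. -/

import Mathlib

open MeasureTheory ProbabilityTheory

/-- The coefficients of the asymmetric and stable by scaling Log-GARCH model of order `(p, q)`.
The index `i : Fin q` (resp. `j : Fin p`) stands for the lag `i + 1` (resp. `j + 1`). -/
structure ASLogGarch (p q : ℕ) where
  /-- the intercept `ω` -/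
  omega : ℝ
  /-- the asymmetry coefficients `ω_{i-}` -/
  omegaNeg : Fin q → ℝ
  /-- the coefficients `α_{i+}` -/
  alphaPos : Fin q → ℝ
  /-- the coefficients `α_{i-}` -/
  alphaNeg : Fin q → ℝ
  /-- the coefficients `β_j` -/
  beta : Fin p → ℝ

/-- `(η_t)` is a sequence of independent and identically distributed real random variables
with `E η_t² = 1`. (A Bochner integral equal to `1` is that of an integrable function.) -/
structure IsIIDNoise {Ω : Type*} [MeasurableSpace Ω] (P : Measure Ω) (η : ℤ → Ω → ℝ) : Prop where
  measurable : ∀ t, Measurable (η t)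
  indep : iIndepFun η P
  identDistrib : ∀ t, IdentDistrib (η t) (η 0) P P
  variance_one : ∫ ω, (η 0 ω) ^ 2 ∂P = 1

namespace ASLogGarch

variable {p q : ℕ} {Ω : Type*} [MeasurableSpace Ω]

/-- `(ε_t)`, with volatility process `(σ_t)`, is a solution of the AS-Log-GARCH model driven by
`(η_t)`: almost surely, for every `t ∈ ℤ`, `σ_t > 0`, `ε_t = σ_t η_t` and
`log σ_t² = ω + ∑_i ω_{i-} 1{ε_{t-i} < 0} + ∑_j β_j log σ_{t-j}²
  + ∑_i (α_{i+} 1{ε_{t-i} > 0} + α_{i-} 1{ε_{t-i} < 0}) log ε_{t-i}²`. -/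
structure IsSolution (θ : ASLogGarch p q) (P : Measure Ω) (η ε σ : ℤ → Ω → ℝ) : Prop where
  measurable_eps : ∀ t, Measurable (ε t)
  measurable_sigma : ∀ t, Measurable (σ t)
  sigma_pos : ∀ᵐ x ∂P, ∀ t, 0 < σ t x
  eps_eq : ∀ᵐ x ∂P, ∀ t, ε t x = σ t x * η t x
  log_sigma_eq : ∀ᵐ x ∂P, ∀ t : ℤ,
    Real.log (σ t x ^ 2) =
      θ.omega
      + ∑ i : Fin q, θ.omegaNeg i * (if ε (t - (i + 1)) x < 0 then 1 else 0)
      + ∑ j : Fin p, θ.beta j * Real.log (σ (t - (j + 1)) x ^ 2)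
      + ∑ i : Fin q,
          (θ.alphaPos i * (if 0 < ε (t - (i + 1)) x then 1 else 0)
            + θ.alphaNeg i * (if ε (t - (i + 1)) x < 0 then 1 else 0))
          * Real.log (ε (t - (i + 1)) x ^ 2)

/-- The row vector `(α_+', α_-', β')`. -/
def coeffRow (θ : ASLogGarch p q) : Fin q ⊕ Fin q ⊕ Fin p → ℝ :=
  Sum.elim θ.alphaPos (Sum.elim θ.alphaNeg θ.beta)

/-- The `(2q+p) × (2q+p)` matrix `C_t` as a function of the value `e` of `η_t`. In each of the
three diagonal blocks, the first row is a multiple (`1{e > 0}`, `1{e < 0}` and `1`,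
respectively) of `(α_+', α_-', β')`, and the other rows form the shift `(I 0)` inside the block. -/
noncomputable def companion (θ : ASLogGarch p q) (e : ℝ) :
    Matrix (Fin q ⊕ Fin q ⊕ Fin p) (Fin q ⊕ Fin q ⊕ Fin p) ℝ :=
  Matrix.of fun r c =>
    match r with
    | .inl i =>
      if (i : ℕ) = 0 then (if 0 < e then 1 else 0) * θ.coeffRow c
      else match c with
        | .inl k => if (k : ℕ) + 1 = i then 1 else 0
        | .inr _ => 0
    | .inr (.inl i) =>
      if (i : ℕ) = 0 then (if e < 0 then 1 else 0) * θ.coeffRow c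
      else match c with
        | .inr (.inl k) => if (k : ℕ) + 1 = i then 1 else 0
        | _ => 0
    | .inr (.inr j) =>
      if (j : ℕ) = 0 then θ.coeffRow c
      else match c with
        | .inr (.inr k) => if (k : ℕ) + 1 = j then 1 else 0
        | _ => 0

end ASLogGarch

section Lyapunov

attribute [local instance] Matrix.linftyOpNormedAddCommGroup

/-- The expectation `E X = E X⁺ - E X⁻` of an extended real random variable. -/
noncomputable def extExpectation {Ω : Type*} [MeasurableSpace Ω] (P : Measure Ω)
    (X : Ω → EReal) : EReal :=
  ((∫⁻ x, (X x).toENNReal ∂P : ENNReal) : EReal)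
    - ((∫⁻ x, (-X x).toENNReal ∂P : ENNReal) : EReal)

/-- The product `C_t C_{t-1} ⋯ C_1` (the identity for `t = 0`). -/
def backwardProd {Ω ι : Type*} [Fintype ι] [DecidableEq ι] (C : ℤ → Ω → Matrix ι ι ℝ) (x : Ω) :
    ℕ → Matrix ι ι ℝ
  | 0 => 1
  | t + 1 => C ((t : ℤ) + 1) x * backwardProd C x t

/-- The top Lyapunov exponent `γ(C) = inf_{t ≥ 1} (1/t) E log ‖C_t C_{t-1} ⋯ C_1‖`, an extended
real number, where `log 0 = -∞` and `‖·‖` is the operator norm associated with the sup norm on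
vectors (a submultiplicative norm). -/
noncomputable def topLyapunov {Ω ι : Type*} [MeasurableSpace Ω] [Fintype ι] [DecidableEq ι]
    (P : Measure Ω) (C : ℤ → Ω → Matrix ι ι ℝ) : EReal :=
  ⨅ t : ℕ,
    extExpectation P (fun x => ENNReal.log (ENNReal.ofReal ‖backwardProd C x (t + 1)‖))
      / ((t + 1 : ℕ) : EReal)

end Lyapunov

section Processes

variable {Ω E : Type*} [MeasurableSpace Ω] [MeasurableSpace E]

/-- The process `(X_t)_{t ∈ ℤ}` is strictly stationary: for every `h`, the processes
`(X_{t+h})_t` and `(X_t)_t` have the same law. -/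
def StrictlyStationary (P : Measure Ω) (X : ℤ → Ω → E) : Prop :=
  ∀ h : ℤ, IdentDistrib (fun x t => X (t + h) x) (fun x t => X t x) P P

/-- The process `(X_t)_{t ∈ ℤ}` is ergodic: the shift of path space is (measure preserving and)
ergodic for the law of the process. -/
def ErgodicProcess (P : Measure Ω) (X : ℤ → Ω → E) : Prop :=
  Ergodic (fun (u : ℤ → E) (t : ℤ) => u (t + 1)) (P.map (fun x t => X t x))

/-- `(X_t)` is non-anticipative with respect to `(η_t)`: for every `t`, `X_t` is almost surely
a measurable function of `η_t, η_{t-1}, η_{t-2}, …`. -/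
def NonAnticipative (P : Measure Ω) (η : ℤ → Ω → ℝ) (X : ℤ → Ω → E) : Prop :=
  ∀ t : ℤ, ∃ g : (ℕ → ℝ) → E, Measurable g ∧
    X t =ᵐ[P] fun x => g (fun s : ℕ => η (t - s) x)

end Processes

open Filter Topology

/-! ### Ergodicity of the Bernoulli shift. -/

section IIDShift

variable {E : Type*} [MeasurableSpace E]

/-! Since `σ_t > 0`, the signs of `ε_t` and `η_t` agree, and `log ε_t² = log σ_t² + log η_t²` when
`η_t ≠ 0`. Hence the vector `Z_t` of recent values of `1{ε > 0} log ε²`, `1{ε < 0} log ε²` and `log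
σ²` satisfies an affine recurrence `Z_t = C_t Z_{t-1} + b_t`, where `C_t` depends only on the sign
of `η_t` and `b_t` only on finitely many noises up to time `t`; conversely `Z_{t-1}` and the past
noises determine `σ_t`.

The engine is `IsIIDNoise.norm_pastProd_decay`: a negative exponent makes `E log ‖C_m ⋯ C_1‖ < 0`
for one `m`. After truncating the logarithm from below to make it integrable, the strong law for
independent blocks of length `m`, together with submultiplicativity, gives almost sure exponential
decay of the products. No subadditive ergodic theorem is needed.

Existence: `E log⁺ |log η_0²| < ∞` makes `log η_{t-k}²` grow slower than any geometric sequence in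
`k`, so the series `∑ₖ C_t ⋯ C_{t-k+1} b_{t-k}` converges and solves the recurrence. The resulting
solution is a fixed measurable function of the shifted noise, hence stationary, non-anticipative,
and ergodic as a factor of a Bernoulli shift.

Uniqueness: the difference of two state vectors satisfies `D_t = C_t ⋯ C_{t-k+1} D_{t-k}`. The
product tends to `0` while `D_{t-k}` stays bounded in probability, so `D_t = 0`. Every stationary
solution therefore inherits the properties of the constructed one. -/

lemma exists_disjoint_image_add (I : Finset ℤ) : ∃ n : ℕ, Disjoint I (I.image (· + (n : ℤ))) := by
  -- If `I ⊆ [-M, M]`, translation by `2M + 1` moves it off itself.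
  refine ⟨2 * I.sup Int.natAbs + 1, ?_⟩
  rw [Finset.disjoint_left]
  intro a ha hb
  obtain ⟨b, hbI, rfl⟩ := Finset.mem_image.1 hb
  have h1 : (b + ((2 * I.sup Int.natAbs + 1 : ℕ) : ℤ)).natAbs ≤ I.sup Int.natAbs :=
    Finset.le_sup (f := Int.natAbs) ha
  have h2 : b.natAbs ≤ I.sup Int.natAbs := Finset.le_sup (f := Int.natAbs) hbI
  omega

lemma measurePreserving_shift_infinitePi (ν : Measure E) [IsProbabilityMeasure ν] (n : ℤ) :
    MeasurePreserving (fun (u : ℤ → E) (t : ℤ) => u (t + n))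
      (Measure.infinitePi fun _ => ν) (Measure.infinitePi fun _ => ν) where
  measurable := by fun_prop
  map_eq := Measure.map_infinitePi_infinitePi_of_inj (P := fun _ : ℤ => ν)
    (f := fun t : ℤ => t + n) (add_left_injective n)

lemma shift_iterate {E : Type*} (n : ℕ) :
    (fun (u : ℤ → E) (t : ℤ) => u (t + 1))^[n] = fun (u : ℤ → E) (t : ℤ) => u (t + n) := by
  induction n with
  | zero => funext u t; simp
  | succ n ih =>
    rw [Function.iterate_succ', ih]
    funext u t
    simp only [Function.comp_apply, Nat.cast_add, Nat.cast_one]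
    congr 1; ring

/-- The two events depend on the disjoint sets of coordinates `I` and `I + n`, hence are
independent. -/
lemma infinitePi_cylinder_inter_shift (ν : Measure E) [IsProbabilityMeasure ν] {I : Finset ℤ}
    {S : Set (I → E)} (hS : MeasurableSet S) {n : ℕ} (hn : Disjoint I (I.image (· + (n : ℤ)))) :
    (Measure.infinitePi fun _ : ℤ => ν)
        (cylinder I S ∩ (fun (u : ℤ → E) (t : ℤ) => u (t + n)) ⁻¹' cylinder I S)
      = (Measure.infinitePi fun _ : ℤ => ν) (cylinder I S) *
        (Measure.infinitePi fun _ : ℤ => ν)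
          ((fun (u : ℤ → E) (t : ℤ) => u (t + n)) ⁻¹' cylinder I S) := by
  have hind : iIndepFun (fun (i : ℤ) (u : ℤ → E) => u i) (Measure.infinitePi fun _ : ℤ => ν) :=
    iIndepFun_infinitePi (X := fun _ x => x) (fun _ => measurable_id)
  have h := hind.indepFun_finset I _ hn (fun i => measurable_pi_apply i)
  let φ : ((I.image (· + (n : ℤ)) : Finset ℤ) → E) → (I → E) :=
    fun w i => w ⟨i + n, Finset.mem_image_of_mem _ i.2⟩
  have hφ : Measurable φ := by fun_prop
  exact (h.comp measurable_id hφ).measure_inter_preimage_eq_mul S S hS hS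

/-- The Bernoulli shift is ergodic. -/
theorem ergodic_shift_infinitePi (ν : Measure E) [IsProbabilityMeasure ν] :
    Ergodic (fun (u : ℤ → E) (t : ℤ) => u (t + 1)) (Measure.infinitePi fun _ => ν) where
  toMeasurePreserving := measurePreserving_shift_infinitePi ν 1
  aeconst_set s hs hinv := by
    set μ : Measure (ℤ → E) := Measure.infinitePi fun _ => ν with hμ
    -- Mixing: approximate `s` within `δ` by a cylinder `D`, and shift `D` until it is independent
    -- of itself. By invariance the shifted `D` still approximates `s`, so `μ s` is within `2δ` of
    -- `(μ D)²`, which is within `2δ` of `(μ s)²`.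
    have key : ∀ δ : ℝ, 0 < δ → |μ.real s - μ.real s * μ.real s| ≤ 4 * δ := by
      intro δ hδ
      obtain ⟨D, hD, hsD⟩ := (Measure.MeasureDense.of_generateFrom_isSetAlgebra_finite (μ := μ)
        isSetAlgebra_measurableCylinders generateFrom_measurableCylinders.symm).approx s hs
          (measure_ne_top _ _) δ hδ
      obtain ⟨I, S, hS, rfl⟩ := (mem_measurableCylinders _).1 hD
      obtain ⟨n, hn⟩ := exists_disjoint_image_add I
      have hDm : MeasurableSet (cylinder (α := fun _ : ℤ => E) I S) :=
        MeasurableSet.of_mem_measurableCylinders hD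
      set D := cylinder (α := fun _ : ℤ => E) I S
      set T : (ℤ → E) → (ℤ → E) := fun u t => u (t + n) with hT
      have hTmp : MeasurePreserving T μ μ := measurePreserving_shift_infinitePi ν n
      have hTs : T ⁻¹' s = s := by
        have := Function.IsFixedPt.preimage_iterate (f := fun (u : ℤ → E) (t : ℤ) => u (t + 1))
          (s := s) hinv n
        rwa [shift_iterate] at this
      have hprod : μ.real (D ∩ T ⁻¹' D) = μ.real D * μ.real D := by
        have h1 : μ (T ⁻¹' D) = μ D := hTmp.measure_preimage hDm.nullMeasurableSet
        have h2 := infinitePi_cylinder_inter_shift ν hS hn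
        rw [← hμ] at h2
        rw [measureReal_def, measureReal_def, ← ENNReal.toReal_mul]
        congr 1
        rw [h2, h1]
      have hd : μ.real (symmDiff s D) ≤ δ := by
        rw [measureReal_def]
        exact ENNReal.toReal_le_of_le_ofReal hδ.le hsD.le
      have hd' : μ.real (symmDiff s (T ⁻¹' D)) ≤ δ := by
        have : symmDiff s (T ⁻¹' D) = T ⁻¹' (symmDiff s D) := by
          conv_lhs => rw [← hTs]
          rfl
        rw [this, measureReal_def, hTmp.measure_preimage (hs.symmDiff hDm).nullMeasurableSet]
        exact hd
      have h1 : |μ.real s - μ.real D| ≤ δ :=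
        (abs_measureReal_sub_le_measureReal_symmDiff hs.nullMeasurableSet
          hDm.nullMeasurableSet).trans hd
      have h2 : |μ.real s - μ.real (D ∩ T ⁻¹' D)| ≤ 2 * δ := by
        refine (abs_measureReal_sub_le_measureReal_symmDiff hs.nullMeasurableSet
          (hDm.inter (hTmp.measurable hDm)).nullMeasurableSet).trans ?_
        have : symmDiff s (D ∩ T ⁻¹' D) ⊆ symmDiff s D ∪ symmDiff s (T ⁻¹' D) := by
          intro x
          simp only [Set.mem_symmDiff, Set.mem_union, Set.mem_inter_iff]
          tauto
        calc μ.real (symmDiff s (D ∩ T ⁻¹' D))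
            ≤ μ.real (symmDiff s D ∪ symmDiff s (T ⁻¹' D)) := measureReal_mono this
          _ ≤ μ.real (symmDiff s D) + μ.real (symmDiff s (T ⁻¹' D)) := measureReal_union_le _ _
          _ ≤ 2 * δ := by linarith
      rw [hprod] at h2
      have hs1 : μ.real s ≤ 1 := measureReal_le_one
      have hD1 : μ.real D ≤ 1 := measureReal_le_one
      have hs0 : 0 ≤ μ.real s := measureReal_nonneg
      have hD0 : 0 ≤ μ.real D := measureReal_nonneg
      rw [abs_le] at h1 h2 ⊢
      constructor <;> nlinarith
    have h0 : μ.real s - μ.real s * μ.real s = 0 := by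
      by_contra hne
      have := key (|μ.real s - μ.real s * μ.real s| / 8) (by positivity)
      have : 0 < |μ.real s - μ.real s * μ.real s| := by positivity
      linarith
    rw [eventuallyConst_set']
    have h01 : μ.real s = 0 ∨ μ.real s = 1 := by
      have : μ.real s * (1 - μ.real s) = 0 := by linarith
      rcases mul_eq_zero.1 this with h | h
      · exact Or.inl h
      · right; linarith
    rcases h01 with h | h
    · left
      rw [measureReal_eq_zero_iff] at h
      exact ae_eq_empty.2 h
    · right
      rw [ae_eq_univ, prob_compl_eq_zero_iff hs]
      rw [measureReal_def] at h
      exact (ENNReal.toReal_eq_one_iff _).1 h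

end IIDShift

/-! ### Stationarity and ergodicity of factors of the noise. -/

section Noise

variable {Ω E : Type*} [MeasurableSpace Ω] [MeasurableSpace E] {P : Measure Ω}
  [IsProbabilityMeasure P] {η : ℤ → Ω → ℝ}

lemma IsIIDNoise.map_reindex (hη : IsIIDNoise P η) {ι : Type*} {f : ι → ℤ}
    (hf : Function.Injective f) :
    P.map (fun x i => η (f i) x) = Measure.infinitePi fun _ => P.map (η 0) := by
  have h := (iIndepFun_iff_map_fun_eq_infinitePi_map (fun i => hη.measurable (f i))).1
    (hη.indep.precomp hf)
  rw [h]
  congr 1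
  funext i
  exact (hη.identDistrib (f i)).map_eq

lemma IsIIDNoise.identDistrib_reindex (hη : IsIIDNoise P η) {ι : Type*} {f g : ι → ℤ}
    (hf : Function.Injective f) (hg : Function.Injective g) :
    IdentDistrib (fun x i => η (f i) x) (fun x i => η (g i) x) P P where
  aemeasurable_fst := (measurable_pi_lambda _ fun i => hη.measurable (f i)).aemeasurable
  aemeasurable_snd := (measurable_pi_lambda _ fun i => hη.measurable (g i)).aemeasurable
  map_eq := by rw [hη.map_reindex hf, hη.map_reindex hg]

/-- `ψ` reads the noise recentred at `t`, so translating the process amounts to translating the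
noise, whose law is invariant. -/
lemma IsIIDNoise.strictlyStationary_factor (hη : IsIIDNoise P η) {ψ : (ℤ → ℝ) → E}
    (hψ : Measurable ψ) : StrictlyStationary P (fun t x => ψ fun s => η (t + s) x) := by
  intro h
  have hid := hη.identDistrib_reindex (g := fun t : ℤ => t) (add_right_injective h)
    Function.injective_id
  have hΨ : Measurable (fun (u : ℤ → ℝ) (t : ℤ) => ψ fun s => u (t + s)) := by
    refine measurable_pi_lambda _ fun t => hψ.comp ?_
    fun_prop
  convert hid.comp hΨ using 1
  · funext x t
    simp only [Function.comp_apply]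
    congr 1
    funext s
    congr 1
    ring
  · rfl

/-- The map from noise paths to process paths commutes with the shifts, and a factor of an ergodic
system is ergodic. -/
lemma IsIIDNoise.ergodicProcess_factor (hη : IsIIDNoise P η) {ψ : (ℤ → ℝ) → E}
    (hψ : Measurable ψ) : ErgodicProcess P (fun t x => ψ fun s => η (t + s) x) := by
  have : IsProbabilityMeasure (P.map (η 0)) :=
    Measure.isProbabilityMeasure_map (hη.measurable 0).aemeasurable
  have hΨ : Measurable (fun (u : ℤ → ℝ) (t : ℤ) => ψ fun s => u (t + s)) := by
    refine measurable_pi_lambda _ fun t => hψ.comp ?_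
    fun_prop
  have hηm : Measurable (fun x (t : ℤ) => η t x) := measurable_pi_lambda _ hη.measurable
  have hlaw := hη.map_reindex (f := fun t : ℤ => t) Function.injective_id
  have hmap : (Measure.infinitePi fun _ : ℤ => P.map (η 0)).map
      (fun (u : ℤ → ℝ) (t : ℤ) => ψ fun s => u (t + s)) =
        P.map (fun x t => ψ fun s => η (t + s) x) := by
    rw [← hlaw, Measure.map_map hΨ hηm]
    rfl
  unfold ErgodicProcess
  refine MeasurePreserving.ergodic_of_ergodic_semiconj ⟨hΨ, hmap⟩
    (ergodic_shift_infinitePi (P.map (η 0))) (by fun_prop) ?_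
  intro u
  funext t
  simp only
  congr 1
  funext s
  congr 1
  ring

end Noise

/-! ### Matrix products along the past. -/

section PastProd

variable {ι : Type*} [Fintype ι] [DecidableEq ι]

/-- The product `A (v 0) * A (v 1) * ⋯ * A (v (k - 1))`. -/
def pastProd (A : ℝ → Matrix ι ι ℝ) : (ℕ → ℝ) → ℕ → Matrix ι ι ℝ
  | _, 0 => 1
  | v, k + 1 => A (v 0) * pastProd A (fun s => v (s + 1)) k

variable {A : ℝ → Matrix ι ι ℝ}

lemma pastProd_add (v : ℕ → ℝ) (k l : ℕ) :
    pastProd A v (k + l) = pastProd A v k * pastProd A (fun s => v (s + k)) l := by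
  induction k generalizing v with
  | zero => simp [pastProd]
  | succ k ih =>
    rw [Nat.add_right_comm, pastProd, pastProd, ih, Matrix.mul_assoc]
    simp only [add_assoc]

lemma pastProd_congr {v w : ℕ → ℝ} {k : ℕ} (h : ∀ s < k, v s = w s) :
    pastProd A v k = pastProd A w k := by
  induction k generalizing v w with
  | zero => rfl
  | succ k ih =>
    rw [pastProd, pastProd, h 0 (by omega), ih fun s hs => h (s + 1) (by omega)]

lemma measurable_pastProd_apply (hA : ∀ i j, Measurable fun e => A e i j) (k : ℕ) (i j : ι) :
    Measurable fun v => pastProd A v k i j := by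
  induction k generalizing i j with
  | zero => simp only [pastProd]; exact measurable_const
  | succ k ih =>
    simp only [pastProd, Matrix.mul_apply]
    refine Finset.measurable_fun_sum _ fun l _ => ?_
    refine ((hA i l).comp (measurable_pi_apply 0)).mul ((ih l j).comp ?_)
    exact measurable_pi_lambda _ fun s => measurable_pi_apply (s + 1)

lemma backwardProd_eq_pastProd {Ω : Type*} (η : ℤ → Ω → ℝ) (x : Ω) (k : ℕ) :
    backwardProd (fun t x => A (η t x)) x k = pastProd A (fun s : ℕ => η (k - s) x) k := by
  induction k with
  | zero => rfl
  | succ k ih =>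
    rw [backwardProd, pastProd, ih]
    simp

attribute [local instance] Matrix.linftyOpNormedAddCommGroup

lemma norm_matrix_one_le : ‖(1 : Matrix ι ι ℝ)‖ ≤ 1 := by
  rw [← Matrix.diagonal_one, Matrix.linfty_opNorm_diagonal]
  exact (pi_norm_le_iff_of_nonneg zero_le_one).2 fun i => by simp

lemma norm_pastProd_le {K : ℝ} (hAK : ∀ e, ‖A e‖ ≤ K) (v : ℕ → ℝ) (k : ℕ) :
    ‖pastProd A v k‖ ≤ K ^ k := by
  have hK : 0 ≤ K := (norm_nonneg _).trans (hAK 0)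
  induction k generalizing v with
  | zero => simpa [pastProd] using norm_matrix_one_le
  | succ k ih =>
    rw [pastProd, pow_succ']
    exact (Matrix.linfty_opNorm_mul _ _).trans (mul_le_mul (hAK _) (ih _) (norm_nonneg _) hK)

lemma measurable_norm_pastProd (hA : ∀ i j, Measurable fun e => A e i j) (k : ℕ) :
    Measurable fun v => ‖pastProd A v k‖ := by
  have hc : Continuous fun M : ι → ι → ℝ => ‖(Matrix.of M : Matrix ι ι ℝ)‖ := by
    simp only [Matrix.linfty_opNorm_def]
    fun_prop
  have hm : Measurable fun (v : ℕ → ℝ) (i j : ι) => pastProd A v k i j :=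
    measurable_pi_lambda _ fun i => measurable_pi_lambda _ fun j =>
      measurable_pastProd_apply hA k i j
  exact hc.measurable.comp hm

end PastProd

/-! ### From a negative Lyapunov exponent to exponential decay. -/

section Lyapunov

attribute [local instance] Matrix.linftyOpNormedAddCommGroup

variable {Ω : Type*} [MeasurableSpace Ω] {P : Measure Ω} [IsProbabilityMeasure P]

/-- The floor `e⁻ⁿ` bounds the logarithm below by `-n`; without it `log N` might fail to be
integrable. -/
lemma integrable_log_max {N : Ω → ℝ} (hN : Measurable N) {K : ℝ} (hNK : ∀ x, N x ≤ K) (n : ℕ) :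
    Integrable (fun x => Real.log (max (N x) (Real.exp (-n)))) P := by
  refine Integrable.of_bound (C := max (n : ℝ) |Real.log (max K (Real.exp (-n)))|)
    (hN.max measurable_const).log.aestronglyMeasurable (ae_of_all _ fun x => ?_)
  have h0 : 0 < Real.exp (-n) := Real.exp_pos _
  rw [Real.norm_eq_abs, abs_le']
  constructor
  · refine le_max_of_le_right (le_trans ?_ (le_abs_self _))
    exact Real.log_le_log (lt_max_of_lt_right h0) (max_le_max_right _ (hNK x))
  · refine le_max_of_le_left ?_
    have := Real.log_le_log h0 (le_max_right (N x) (Real.exp (-n)))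
    rw [Real.log_exp] at this
    linarith

/-- If `E log N < 0` for a bounded nonnegative `N`, then `E log (max N e⁻ⁿ) < 0` for large `n`. -/
lemma exists_integral_log_max_neg {N : Ω → ℝ} (hN : Measurable N) (hN0 : ∀ x, 0 ≤ N x) {K : ℝ}
    (hNK : ∀ x, N x ≤ K)
    (hneg : extExpectation P (fun x => ENNReal.log (ENNReal.ofReal (N x))) < 0) :
    ∃ n : ℕ, ∫ x, Real.log (max (N x) (Real.exp (-n))) ∂P < 0 := by
  set X : Ω → EReal := fun x => ENNReal.log (ENNReal.ofReal (N x)) with hX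
  have hXm : Measurable X := by fun_prop
  have hXr : ∀ x, 0 < N x → X x = (Real.log (N x) : EReal) := fun x hx =>
    ENNReal.log_ofReal_of_pos hx
  have hX0 : ∀ x, N x = 0 → X x = ⊥ := fun x hx => by simp [hX, hx]
  -- As `e⁻ⁿ ≤ 1`, the floor leaves the positive part of the logarithm unchanged; it only caps the
  -- negative part at `n`. Monotone convergence in `n` then recovers the full negative part.
  have hpos : ∀ (n : ℕ) x, ENNReal.ofReal (Real.log (max (N x) (Real.exp (-n))))
      = (X x).toENNReal := by
    intro n x
    rcases (hN0 x).eq_or_lt with h | h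
    · rw [hX0 x h.symm, ← h, max_eq_right (Real.exp_pos _).le, Real.log_exp]
      simp
    · rw [hXr x h, EReal.toENNReal_of_ne_top (EReal.coe_ne_top _), EReal.toReal_coe]
      rcases le_total (Real.exp (-n)) (N x) with h' | h'
      · rw [max_eq_left h']
      · rw [max_eq_right h', Real.log_exp, ENNReal.ofReal_of_nonpos (by simp),
          ENNReal.ofReal_of_nonpos]
        refine Real.log_nonpos h.le (h'.trans ?_)
        rw [Real.exp_le_one_iff]; simp
  have hnegp : ∀ (n : ℕ) x, ENNReal.ofReal (-Real.log (max (N x) (Real.exp (-n))))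
      = min (-X x).toENNReal n := by
    intro n x
    rcases (hN0 x).eq_or_lt with h | h
    · rw [hX0 x h.symm, ← h, max_eq_right (Real.exp_pos _).le, Real.log_exp]
      simp
    · rw [hXr x h, ← EReal.coe_neg, EReal.toENNReal_of_ne_top (EReal.coe_ne_top _),
        EReal.toReal_coe, ← ENNReal.ofReal_natCast n, ← ENNReal.ofReal_min]
      congr 1
      rcases le_total (Real.exp (-n)) (N x) with h' | h'
      · rw [max_eq_left h', min_eq_left]
        have := Real.log_le_log (Real.exp_pos _) h'
        rw [Real.log_exp] at this
        linarith
      · rw [max_eq_right h', Real.log_exp, min_eq_right, neg_neg]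
        have := Real.log_le_log h h'
        rw [Real.log_exp] at this
        linarith
  have hfin : ∫⁻ x, (X x).toENNReal ∂P ≠ ⊤ := by
    have h : ∫⁻ x, _ ∂P < ⊤ := (integrable_log_max (P := P) hN hNK 0).hasFiniteIntegral
    refine ne_top_of_le_ne_top h.ne (lintegral_mono fun x => ?_)
    simp only
    rw [← hpos 0 x]
    exact Real.ofReal_le_enorm _
  have hlt : ∫⁻ x, (X x).toENNReal ∂P < ∫⁻ x, (-X x).toENNReal ∂P := by
    by_contra hle
    rw [not_lt] at hle
    have : (0 : EReal) ≤ extExpectation P X := by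
      unfold extExpectation
      rw [EReal.sub_nonneg]
      · exact_mod_cast hle
      · left; simpa using hfin
      · left; simp
    exact absurd hneg (not_lt.2 this)
  have hsup : ∫⁻ x, (-X x).toENNReal ∂P = ⨆ n : ℕ, ∫⁻ x, min (-X x).toENNReal n ∂P := by
    rw [← lintegral_iSup]
    · congr 1
      funext x
      rw [← inf_iSup_eq, ENNReal.iSup_natCast, inf_top_eq]
    · intro n
      exact (hXm.neg.ereal_toENNReal).min measurable_const
    · intro n m hnm x
      exact min_le_min_left _ (by exact_mod_cast hnm)
  rw [hsup, lt_iSup_iff] at hlt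
  obtain ⟨n, hn⟩ := hlt
  refine ⟨n, ?_⟩
  rw [integral_eq_lintegral_pos_part_sub_lintegral_neg_part (integrable_log_max hN hNK n)]
  simp only [hpos, hnegp]
  rw [sub_neg]
  refine (ENNReal.toReal_lt_toReal hfin ?_).2 hn
  refine ne_top_of_le_ne_top (ENNReal.natCast_ne_top n) ?_
  calc ∫⁻ x, min (-X x).toENNReal n ∂P ≤ ∫⁻ _, (n : ENNReal) ∂P :=
        lintegral_mono fun x => min_le_right _ _
    _ = n := by simp

/-- The strong law of large numbers for a function of disjoint blocks of length `m`. -/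
lemma IsIIDNoise.strong_law_blocks {η : ℤ → Ω → ℝ} (hη : IsIIDNoise P η) {m : ℕ}
    {G : (ℕ → ℝ) → ℝ} (hG : Measurable G) (hGm : ∀ v w, (∀ s < m, v s = w s) → G v = G w)
    (T T' : ℤ) (hint : Integrable (fun x => G fun s => η (T' - s) x) P) :
    ∀ᵐ x ∂P, Tendsto
      (fun n : ℕ => (∑ j ∈ Finset.range n, G fun s => η (T - (s + j * m : ℕ)) x) / n) atTop
      (𝓝 (∫ x, G (fun s => η (T' - s) x) ∂P)) := by
  have hinj : ∀ (T : ℤ) (a : ℕ), Function.Injective fun s : ℕ => T - ((s + a : ℕ) : ℤ) := by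
    intro T a s t hst
    simp only at hst
    omega
  have hid : ∀ (T₁ T₂ : ℤ) (a b : ℕ), IdentDistrib (fun x => G fun s => η (T₁ - (s + a : ℕ)) x)
      (fun x => G fun s => η (T₂ - (s + b : ℕ)) x) P P := fun T₁ T₂ a b =>
    (hη.identDistrib_reindex (hinj T₁ a) (hinj T₂ b)).comp hG
  have hid' : ∀ j : ℕ, IdentDistrib (fun x => G fun s => η (T - (s + j * m : ℕ)) x)
      (fun x => G fun s => η (T' - s) x) P P := fun j => by
    simpa using hid T T' (j * m) 0
  have hindep : iIndepFun (fun s : ℕ => η (T - s)) P :=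
    hη.indep.precomp (g := fun s : ℕ => T - s) (by intro s t h; simp only at h; omega)
  have hlaw := strong_law_ae_real (μ := P)
    (fun (j : ℕ) x => G fun s => η (T - (s + j * m : ℕ)) x) ((hid' 0).integrable_iff.2 hint) ?_
    (fun j => hid T T (j * m) (0 * m))
  · rwa [(hid' 0).integral_eq] at hlaw
  · intro i j hij
    let S : ℕ → Finset ℕ := fun i => Finset.Ico (i * m) (i * m + m)
    have hS : Disjoint (S i) (S j) := by
      rw [Finset.disjoint_left]
      intro a ha hb
      simp only [S, Finset.mem_Ico] at ha hb
      rcases lt_or_gt_of_ne hij with h | h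
      · have := Nat.mul_le_mul_right m (Nat.succ_le_of_lt h)
        rw [Nat.succ_mul] at this
        omega
      · have := Nat.mul_le_mul_right m (Nat.succ_le_of_lt h)
        rw [Nat.succ_mul] at this
        omega
    -- Rebuild a sequence from the noises of block `i` alone; the padding by `0` is harmless because
    -- `G` reads only the first `m` terms.
    let φ : ∀ i, (S i → ℝ) → (ℕ → ℝ) := fun i w s =>
      if h : s + i * m ∈ S i then w ⟨s + i * m, h⟩ else 0
    have hφ : ∀ i, Measurable (φ i) := by
      intro i
      refine measurable_pi_lambda _ fun s => ?_
      by_cases h : s + i * m ∈ S i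
      · simp only [φ, h, dite_true]; exact measurable_pi_apply _
      · simp only [φ, h, dite_false]; exact measurable_const
    have hfac : ∀ i, (fun x => G fun s => η (T - (s + i * m : ℕ)) x) =
        (G ∘ φ i) ∘ fun x (s : S i) => η (T - (s : ℕ)) x := by
      intro i
      funext x
      refine hGm _ _ fun s hs => ?_
      have : s + i * m ∈ S i := by simp only [S, Finset.mem_Ico]; omega
      simp only [φ, this, dite_true]
    have := hindep.indepFun_finset (S i) (S j) hS (fun s => hη.measurable _)
    simp only [Function.onFun]
    rw [hfac i, hfac j]
    exact this.comp (hG.comp (hφ i)) (hG.comp (hφ j))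

variable {ι : Type*} [Fintype ι] [DecidableEq ι] {A : ℝ → Matrix ι ι ℝ}

/-- Submultiplicativity over blocks. The floor also keeps the argument of `Real.log` positive, so
that `exp` undoes it even when a block product vanishes. -/
lemma norm_pastProd_mul_le_exp_sum (m n₀ : ℕ) (v : ℕ → ℝ) (n : ℕ) :
    ‖pastProd A v (n * m)‖ ≤ Real.exp (∑ j ∈ Finset.range n,
      Real.log (max ‖pastProd A (fun s => v (s + j * m)) m‖ (Real.exp (-n₀)))) := by
  induction n with
  | zero => simpa [pastProd] using norm_matrix_one_le
  | succ n ih =>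
    rw [Nat.succ_mul, pastProd_add, Finset.sum_range_succ, Real.exp_add,
      Real.exp_log (lt_max_of_lt_right (Real.exp_pos _))]
    exact (Matrix.linfty_opNorm_mul _ _).trans
      (mul_le_mul ih (le_max_left _ _) (norm_nonneg _) (Real.exp_pos _).le)

/-- A negative top Lyapunov exponent gives exponential decay of the products. -/
theorem IsIIDNoise.norm_pastProd_decay {η : ℤ → Ω → ℝ} (hη : IsIIDNoise P η)
    (hA : ∀ i j, Measurable fun e => A e i j) {K : ℝ} (hAK : ∀ e, ‖A e‖ ≤ K)
    (hγ : topLyapunov P (fun t x => A (η t x)) < 0) :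
    ∃ c ρ : ℝ, 0 < ρ ∧ ρ < 1 ∧ ∀ T : ℤ, ∀ᵐ x ∂P, ∀ᶠ k : ℕ in atTop,
      ‖pastProd A (fun s : ℕ => η (T - s) x) k‖ ≤ c * ρ ^ k := by
  -- With `K ≥ 1`, an incomplete block of fewer than `m` factors costs at most `K ^ m`.
  wlog hK1 : 1 ≤ K generalizing K
  · exact this (K := max K 1) (fun e => (hAK e).trans (le_max_left _ _)) (le_max_right _ _)
  unfold topLyapunov at hγ
  obtain ⟨t, ht⟩ := iInf_lt_iff.1 hγ
  set m := t + 1 with hm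
  have hm0 : 0 < m := Nat.succ_pos t
  simp only [backwardProd_eq_pastProd] at ht
  have ht' : extExpectation P (fun x => ENNReal.log (ENNReal.ofReal
      ‖pastProd A (fun s : ℕ => η (m - s) x) m‖)) < 0 := by
    by_contra hle
    refine absurd ht (not_lt.2 (EReal.div_nonneg (not_lt.1 hle) ?_))
    exact_mod_cast Nat.zero_le _
  have hpm : ∀ T : ℤ, Measurable fun x (s : ℕ) => η (T - s) x := fun T =>
    measurable_pi_lambda _ fun s => hη.measurable _
  have hNm := (measurable_norm_pastProd hA m).comp (hpm m)
  obtain ⟨n₀, hn₀⟩ := exists_integral_log_max_neg hNm (fun _ => norm_nonneg _)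
    (fun x => norm_pastProd_le hAK _ m) ht'
  set G : (ℕ → ℝ) → ℝ := fun v => Real.log (max ‖pastProd A v m‖ (Real.exp (-n₀))) with hGdef
  have hG : Measurable G :=
    Real.measurable_log.comp ((measurable_norm_pastProd hA m).max measurable_const)
  have hGm : ∀ v w : ℕ → ℝ, (∀ s < m, v s = w s) → G v = G w := fun v w h => by
    simp only [hGdef, pastProd_congr h]
  have hint : Integrable (fun x => G fun s : ℕ => η (m - s) x) P :=
    integrable_log_max hNm (fun x => norm_pastProd_le hAK _ m) n₀
  set e := ∫ x, G (fun s : ℕ => η (m - s) x) ∂P with he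
  have he0 : e < 0 := hn₀
  -- Block averages are eventually below `e / 2`, hence a bound `exp (e n / 2)` after `n` blocks.
  -- With `n = ⌊k / m⌋ ≥ k / m - 1`, this gives the rate `exp (e / (2m))`; the rounding costs `exp
  -- (-e / 2)` and the remainder `K ^ m`.
  refine ⟨Real.exp (-(e / 2)) * K ^ m, Real.exp (e / 2 / m), Real.exp_pos _, ?_, fun T => ?_⟩
  · rw [Real.exp_lt_one_iff]
    have : (0 : ℝ) < m := by exact_mod_cast hm0
    exact div_neg_of_neg_of_pos (by linarith) this
  filter_upwards [hη.strong_law_blocks hG hGm T m hint] with x hx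
  have h1 : ∀ᶠ n : ℕ in atTop,
      ‖pastProd A (fun s : ℕ => η (T - s) x) (n * m)‖ ≤ Real.exp (e / 2 * n) := by
    filter_upwards [hx.eventually_lt_const (show e < e / 2 by linarith), eventually_gt_atTop 0]
      with n hn hn0
    refine (norm_pastProd_mul_le_exp_sum m n₀ _ n).trans (Real.exp_le_exp.2 ?_)
    rw [div_lt_iff₀ (by exact_mod_cast hn0)] at hn
    exact hn.le
  filter_upwards [(Nat.tendsto_div_const_atTop hm0.ne').eventually h1] with k hk
  have hkm : (k : ℝ) / m - 1 ≤ ((k / m : ℕ) : ℝ) := by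
    have hm0' : (0 : ℝ) < m := by exact_mod_cast hm0
    rw [sub_le_iff_le_add, div_le_iff₀ hm0']
    have : k < (k / m + 1) * m := Nat.lt_mul_of_div_lt (Nat.lt_succ_self _) hm0
    exact_mod_cast this.le
  have hsplit : k = k / m * m + k % m := (Nat.div_add_mod' k m).symm
  rw [hsplit, pastProd_add, ← hsplit]
  refine (Matrix.linfty_opNorm_mul _ _).trans ?_
  calc _ ≤ Real.exp (e / 2 * (k / m : ℕ)) * K ^ m :=
        mul_le_mul hk ((norm_pastProd_le hAK _ _).trans
          (pow_le_pow_right₀ hK1 (Nat.mod_lt _ hm0).le)) (norm_nonneg _) (Real.exp_pos _).le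
    _ ≤ Real.exp (e / 2 * (k / m - 1)) * K ^ m := by
        refine mul_le_mul_of_nonneg_right (Real.exp_le_exp.2 ?_) (by positivity)
        exact mul_le_mul_of_nonpos_left hkm (by linarith)
    _ = _ := by
        rw [mul_right_comm, ← Real.exp_nat_mul, ← Real.exp_add]
        congr 2
        ring

/-- By the strong law, the terms `Y k = log⁺ |log η²|` are `o(k)`, hence eventually below `(k + 1)
log κ`. -/
lemma IsIIDNoise.posLog_abs_log_growth {η : ℤ → Ω → ℝ} (hη : IsIIDNoise P η)
    (hη_log : Integrable (fun x => Real.posLog |Real.log (η 0 x ^ 2)|) P) (T : ℤ) :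
    ∀ᵐ x ∂P, ∀ κ : ℝ, 1 < κ → ∀ᶠ k : ℕ in atTop, |Real.log (η (T - k) x ^ 2)| ≤ κ ^ (k + 1) := by
  have hlaw := hη.strong_law_blocks (m := 1) (G := fun v => Real.posLog |Real.log (v 0 ^ 2)|)
    (by unfold Real.posLog; fun_prop) (fun v w h => by simp only [h 0 one_pos]) T 0
    (by simpa using hη_log)
  filter_upwards [hlaw] with x hx κ hκ
  simp only [zero_add, mul_one] at hx
  set Y : ℕ → ℝ := fun k => Real.posLog |Real.log (η (T - k) x ^ 2)|
  set e := ∫ x, Real.posLog |Real.log (η (0 - (0 : ℕ)) x ^ 2)| ∂P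
  have h1 : Tendsto (fun n : ℕ => Y n / (n + 1 : ℕ)) atTop (𝓝 0) := by
    -- With `S n` the partial sums, `Y n / (n + 1) = S (n + 1) / (n + 1) - (S n / n) (n / (n + 1))`,
    -- and both terms tend to `e`.
    have h2 := (hx.comp (tendsto_add_atTop_nat 1)).sub
      (hx.mul (tendsto_natCast_div_add_atTop (1 : ℝ)))
    rw [mul_one, sub_self] at h2
    refine h2.congr' ?_
    filter_upwards [eventually_gt_atTop 0] with n hn
    have hn' : (n : ℝ) ≠ 0 := by exact_mod_cast hn.ne'
    simp only [Function.comp_apply, Finset.sum_range_succ]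
    push_cast
    field_simp
    ring
  filter_upwards [h1.eventually_lt_const (Real.log_pos hκ)] with k hk
  rw [div_lt_iff₀ (by positivity)] at hk
  rcases (abs_nonneg (Real.log (η (T - k) x ^ 2))).eq_or_lt with h0 | h0
  · rw [← h0]; positivity
  · rw [← Real.log_le_log_iff h0 (by positivity), Real.log_pow κ (k + 1)]
    have : Real.log |Real.log (η (T - k) x ^ 2)| ≤ Y k := le_max_right _ _
    linarith

end Lyapunov

/-! ### The series solving the affine recurrence. -/

section RecurrenceSolution

variable {ι : Type*} [Fintype ι] [DecidableEq ι]

/-- The solution `∑ₖ A (v 0) ⋯ A (v (k - 1)) b (v k, v (k + 1), …)` of the stochastic recurrence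
equation `z (v) = b (v) + A (v 0) z (v 1, v 2, …)`. -/
noncomputable def recurrenceSolution (A : ℝ → Matrix ι ι ℝ) (b : (ℕ → ℝ) → ι → ℝ) (v : ℕ → ℝ) :
    ι → ℝ :=
  ∑' k : ℕ, (pastProd A v k).mulVec (b fun s => v (s + k))

variable {A : ℝ → Matrix ι ι ℝ} {b : (ℕ → ℝ) → ι → ℝ}

lemma measurable_recurrenceSolution (hA : ∀ i j, Measurable fun e => A e i j)
    (hb : Measurable b) : Measurable (recurrenceSolution A b) := by
  refine Measurable.tsum fun k => measurable_pi_lambda _ fun i => ?_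
  simp only [Matrix.mulVec, dotProduct]
  refine Finset.measurable_fun_sum _ fun j _ => (measurable_pastProd_apply hA k i j).mul ?_
  have hs : Measurable fun (v : ℕ → ℝ) (s : ℕ) => v (s + k) :=
    measurable_pi_lambda _ fun s => measurable_pi_apply _
  exact (measurable_pi_apply j).comp (hb.comp hs)

/-- The term `k = 0` is `b v`, and `A (v 0)` factors out of all the others, leaving the series of
the shifted sequence. -/
lemma recurrenceSolution_eq {v : ℕ → ℝ}
    (hv : Summable fun k : ℕ => (pastProd A v k).mulVec (b fun s => v (s + k)))
    (hv' : Summable fun k : ℕ =>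
      (pastProd A (fun s => v (s + 1)) k).mulVec (b fun s => v (s + k + 1))) :
    recurrenceSolution A b v =
      (A (v 0)).mulVec (recurrenceSolution A b fun s => v (s + 1)) + b v := by
  unfold recurrenceSolution
  rw [hv.tsum_eq_zero_add, add_comm]
  congr 1
  · have h := (LinearMap.toContinuousLinearMap (Matrix.mulVecLin (A (v 0)))).map_tsum hv'
    simp only [LinearMap.coe_toContinuousLinearMap', Matrix.mulVecLin_apply] at h
    rw [h]
    refine tsum_congr fun k => ?_
    rw [pastProd, Matrix.mulVec_mulVec]
    rfl
  · simp [pastProd]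

end RecurrenceSolution

/-! ### Convergence of the series, and uniqueness among solutions bounded in probability. -/

section Stochastic

attribute [local instance] Matrix.linftyOpNormedAddCommGroup

variable {Ω : Type*} [MeasurableSpace Ω] {P : Measure Ω} [IsProbabilityMeasure P]
  {ι : Type*} [Fintype ι] [DecidableEq ι] {A : ℝ → Matrix ι ι ℝ} {b : (ℕ → ℝ) → ι → ℝ}

theorem IsIIDNoise.summable_recurrence {η : ℤ → Ω → ℝ} (hη : IsIIDNoise P η)
    (hη_log : Integrable (fun x => Real.posLog |Real.log (η 0 x ^ 2)|) P)
    (hA : ∀ i j, Measurable fun e => A e i j) {K : ℝ} (hAK : ∀ e, ‖A e‖ ≤ K)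
    (hγ : topLyapunov P (fun t x => A (η t x)) < 0) {B : ℝ}
    (hb : ∀ v, ‖b v‖ ≤ B + |Real.log (v 0 ^ 2)|) (T : ℤ) :
    ∀ᵐ x ∂P, Summable fun k : ℕ => (pastProd A (fun s : ℕ => η (T - s) x) k).mulVec
      (b fun s => η (T - (s + k : ℕ)) x) := by
  obtain ⟨c, ρ, hρ0, hρ1, hdecay⟩ := hη.norm_pastProd_decay hA hAK hγ
  -- The midpoint of `1` and `1 / ρ`: growth at rate `κ > 1` is still beaten by the decay, as `ρ κ =
  -- (1 + ρ) / 2 < 1`.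
  set κ := (1 + 1 / ρ) / 2 with hκ
  have hρinv : 1 < 1 / ρ := by rw [lt_div_iff₀ hρ0]; linarith
  have hκ1 : 1 < κ := by rw [hκ]; linarith
  have hρκ : ρ * κ < 1 := by
    have : ρ * κ = (ρ + 1) / 2 := by rw [hκ]; field_simp
    linarith
  filter_upwards [hdecay T, hη.posLog_abs_log_growth hη_log T] with x hx hgrow
  have hs : Summable fun k : ℕ => c * B * ρ ^ k + c * κ * (ρ * κ) ^ k :=
    ((summable_geometric_of_lt_one hρ0.le hρ1).mul_left _).add
      ((summable_geometric_of_lt_one (by positivity) hρκ).mul_left _)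
  refine hs.of_norm_bounded_eventually_nat ?_
  filter_upwards [hx, hgrow κ hκ1] with k hk hk'
  refine (Matrix.linfty_opNorm_mulVec _ _).trans ?_
  calc _ ≤ c * ρ ^ k * (B + κ ^ (k + 1)) := by
        refine mul_le_mul hk ((hb _).trans ?_) (norm_nonneg _) ((norm_nonneg _).trans hk)
        simpa using hk'
    _ = _ := by rw [mul_pow]; ring

theorem IsIIDNoise.recurrenceSolution_recursion {η : ℤ → Ω → ℝ} (hη : IsIIDNoise P η)
    (hη_log : Integrable (fun x => Real.posLog |Real.log (η 0 x ^ 2)|) P)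
    (hA : ∀ i j, Measurable fun e => A e i j) {K : ℝ} (hAK : ∀ e, ‖A e‖ ≤ K)
    (hγ : topLyapunov P (fun t x => A (η t x)) < 0) {B : ℝ}
    (hb : ∀ v, ‖b v‖ ≤ B + |Real.log (v 0 ^ 2)|) :
    ∀ᵐ x ∂P, ∀ t : ℤ, recurrenceSolution A b (fun s : ℕ => η (t - s) x) =
      (A (η t x)).mulVec (recurrenceSolution A b fun s : ℕ => η (t - 1 - s) x)
        + b fun s : ℕ => η (t - s) x := by
  have h := ae_all_iff.2 fun T => hη.summable_recurrence hη_log hA hAK hγ hb T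
  filter_upwards [h] with x hx t
  have hshift : ∀ s : ℕ, t - 1 - (s : ℤ) = t - (s + 1 : ℕ) := fun s => by push_cast; ring
  have h2 := hx (t - 1)
  simp only [hshift] at h2 ⊢
  have := recurrenceSolution_eq (hx t) h2
  simpa using this

/-- `sup_t P (D_t > R) → 0` as `R → ∞`. -/
def BoundedAboveInProbability (P : Measure Ω) (D : ℤ → Ω → ℝ) : Prop :=
  ∀ δ : ENNReal, 0 < δ → ∃ R : ℝ, ∀ t, P {x | R < D t x} ≤ δ

omit [IsProbabilityMeasure P] in
lemma BoundedAboveInProbability.add {D D' : ℤ → Ω → ℝ} (h : BoundedAboveInProbability P D)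
    (h' : BoundedAboveInProbability P D') :
    BoundedAboveInProbability P (fun t x => D t x + D' t x) := by
  intro δ hδ
  obtain ⟨R, hR⟩ := h (δ / 2) (ENNReal.half_pos hδ.ne')
  obtain ⟨R', hR'⟩ := h' (δ / 2) (ENNReal.half_pos hδ.ne')
  refine ⟨R + R', fun t => ?_⟩
  calc P {x | R + R' < D t x + D' t x} ≤ P ({x | R < D t x} ∪ {x | R' < D' t x}) := by
        refine measure_mono fun x hx => ?_
        simp only [Set.mem_ofPred_eq, Set.mem_union] at hx ⊢
        by_contra! hc
        linarith [hc.1, hc.2]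
    _ ≤ δ / 2 + δ / 2 := (measure_union_le _ _).trans (add_le_add (hR t) (hR' t))
    _ = δ := ENNReal.add_halves δ

omit [IsProbabilityMeasure P] in
lemma BoundedAboveInProbability.mono {D D' : ℤ → Ω → ℝ} (h : BoundedAboveInProbability P D')
    (hle : ∀ t, ∀ᵐ x ∂P, D t x ≤ D' t x) : BoundedAboveInProbability P D := by
  intro δ hδ
  obtain ⟨R, hR⟩ := h δ hδ
  refine ⟨R, fun t => (measure_mono_ae ?_).trans (hR t)⟩
  filter_upwards [hle t] with x hx hlt
  exact lt_of_lt_of_le hlt hx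

omit [IsProbabilityMeasure P] in
lemma BoundedAboveInProbability.comp {D : ℤ → Ω → ℝ} (h : BoundedAboveInProbability P D)
    (f : ℤ → ℤ) : BoundedAboveInProbability P (fun t => D (f t)) := fun δ hδ =>
  let ⟨R, hR⟩ := h δ hδ
  ⟨R, fun t => hR (f t)⟩

omit [IsProbabilityMeasure P] in
lemma BoundedAboveInProbability.sum {κ : Type*} (S : Finset κ) {D : κ → ℤ → Ω → ℝ}
    (h : ∀ i ∈ S, BoundedAboveInProbability P (D i)) :
    BoundedAboveInProbability P (fun t x => ∑ i ∈ S, D i t x) := by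
  classical
  induction S using Finset.induction_on with
  | empty => exact fun δ _ => ⟨0, fun t => by simp⟩
  | insert a S ha ih =>
    simp only [Finset.sum_insert ha]
    exact (h a (Finset.mem_insert_self _ _)).add
      (ih fun i hi => h i (Finset.mem_insert_of_mem hi))

/-- The probabilities do not depend on `t`, and a single real random variable is tight. -/
lemma BoundedAboveInProbability.of_identDistrib {D : ℤ → Ω → ℝ}
    (h : ∀ t, IdentDistrib (D t) (D 0) P P) : BoundedAboveInProbability P D := by
  intro δ hδ
  have hlim : Tendsto (fun n : ℕ => P {x | (n : ℝ) < D 0 x}) atTop (𝓝 0) := by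
    have hempty : ⋂ n : ℕ, {x | (n : ℝ) < D 0 x} = ∅ := by
      ext x
      simp only [Set.mem_iInter, Set.mem_ofPred_eq, Set.mem_empty_iff_false, iff_false, not_forall,
        not_lt]
      exact exists_nat_ge (D 0 x)
    rw [← measure_empty (μ := P), ← hempty]
    refine tendsto_measure_iInter_atTop (fun n => ?_) ?_ ⟨0, measure_ne_top _ _⟩
    · exact nullMeasurableSet_lt aemeasurable_const (h 0).aemeasurable_fst
    · intro n m hnm x hx
      have : (n : ℝ) ≤ m := by exact_mod_cast hnm
      exact lt_of_le_of_lt this hx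
  obtain ⟨n, hn⟩ := (hlim.eventually_le_const hδ).exists
  refine ⟨n, fun t => ?_⟩
  have := (h t).measure_mem_eq (s := Set.Ioi (n : ℝ)) measurableSet_Ioi
  exact this.trans_le hn

/-- A homogeneous recurrence with negative Lyapunov exponent has no nonzero solution that is
bounded in probability. -/
theorem IsIIDNoise.homogeneous_recurrence_eq_zero {η : ℤ → Ω → ℝ} (hη : IsIIDNoise P η)
    (hA : ∀ i j, Measurable fun e => A e i j) {K : ℝ} (hAK : ∀ e, ‖A e‖ ≤ K)
    (hγ : topLyapunov P (fun t x => A (η t x)) < 0) {D : ℤ → Ω → ι → ℝ}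
    (hD : ∀ᵐ x ∂P, ∀ t, D t x = (A (η t x)).mulVec (D (t - 1) x))
    (hbdd : BoundedAboveInProbability P (fun t x => ‖D t x‖)) (t : ℤ) :
    ∀ᵐ x ∂P, D t x = 0 := by
  obtain ⟨c, ρ, hρ0, hρ1, hdecay⟩ := hη.norm_pastProd_decay hA hAK hγ
  have hiter : ∀ᵐ x ∂P, ∀ k : ℕ,
      D t x = (pastProd A (fun s : ℕ => η (t - s) x) k).mulVec (D (t - k) x) := by
    filter_upwards [hD] with x hx k
    induction k generalizing t with
    | zero => simp [pastProd]
    | succ k ih =>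
      rw [pastProd, hx t, ih (t - 1), Matrix.mulVec_mulVec]
      have hshift : ∀ s : ℕ, t - 1 - (s : ℤ) = t - (s + 1 : ℕ) := fun s => by push_cast; ring
      simp only [hshift]
      simp
  -- Almost sure decay is weakened to convergence in measure because `D (t - k)` is controlled only
  -- in probability, uniformly in `k`.
  have hmeas : TendstoInMeasure P
      (fun (k : ℕ) x => ‖pastProd A (fun s : ℕ => η (t - s) x) k‖) atTop (fun _ => (0 : ℝ)) := by
    refine tendstoInMeasure_of_tendsto_ae (fun k => ?_) ?_
    · exact ((measurable_norm_pastProd hA k).comp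
        (measurable_pi_lambda _ fun s => hη.measurable _)).aestronglyMeasurable
    · filter_upwards [hdecay t] with x hx
      refine squeeze_zero' (Eventually.of_forall fun _ => norm_nonneg _) hx ?_
      simpa using (tendsto_pow_atTop_nhds_zero_of_lt_one hρ0.le hρ1).const_mul c
  have hzero : ∀ r : ℝ, 0 < r → P {x | r ≤ ‖D t x‖} = 0 := by
    intro r hr
    refine le_antisymm (ENNReal.le_of_forall_pos_le_add fun δ hδ _ => ?_) zero_le
    have hδ' : (0 : ENNReal) < (δ : ENNReal) / 2 := ENNReal.half_pos (by simpa using hδ.ne')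
    -- Choose `R` first, uniformly in time, then `k` so that the product is below `r / R'` except on
    -- an event of probability `δ / 2`. Taking `R' ≥ 1` keeps this threshold meaningful.
    obtain ⟨R, hR⟩ := hbdd _ hδ'
    set R' := max R 1
    have hR'0 : 0 < R' := lt_max_of_lt_right one_pos
    have hk := tendstoInMeasure_iff_norm.1 hmeas (r / R') (by positivity)
    obtain ⟨k, hk⟩ := (hk.eventually_le_const hδ').exists
    rw [zero_add]
    calc P {x | r ≤ ‖D t x‖}
        ≤ P ({x | r / R' ≤ ‖‖pastProd A (fun s : ℕ => η (t - s) x) k‖ - 0‖} ∪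
            {x | R < ‖D (t - k) x‖}) := by
          refine measure_mono_ae ?_
          filter_upwards [hiter] with x hx hrx
          change r ≤ ‖D t x‖ at hrx
          change _ ∨ _
          by_contra! hc
          obtain ⟨h1, h2⟩ := hc
          simp only [Set.mem_ofPred_eq, sub_zero, norm_norm, not_le] at h1
          replace h2 : ‖D (t - k) x‖ ≤ R := not_lt.1 h2
          rw [hx k] at hrx
          have h3 := hrx.trans (Matrix.linfty_opNorm_mulVec _ _)
          have h4 : ‖pastProd A (fun s : ℕ => η (t - s) x) k‖ * ‖D (t - k) x‖
              ≤ ‖pastProd A (fun s : ℕ => η (t - s) x) k‖ * R' :=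
            mul_le_mul_of_nonneg_left (h2.trans (le_max_left _ _)) (norm_nonneg _)
          rw [lt_div_iff₀ hR'0] at h1
          linarith
      _ ≤ δ / 2 + δ / 2 := (measure_union_le _ _).trans (add_le_add hk (hR _))
      _ = δ := ENNReal.add_halves _
  have hall : ∀ᵐ x ∂P, ∀ n : ℕ, ‖D t x‖ < 1 / ((n : ℝ) + 1) := by
    refine ae_all_iff.2 fun n => ?_
    rw [ae_iff]
    simpa only [not_lt] using hzero _ (by positivity)
  filter_upwards [hall] with x hx
  rw [← norm_le_zero_iff]
  exact ge_of_tendsto' tendsto_one_div_add_atTop_nhds_zero_nat fun n => (hx n).le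

end Stochastic

/-! ### The model as a vector recurrence. -/

namespace ASLogGarch

variable {p q : ℕ} (θ : ASLogGarch p q)

lemma companion_mulVec_inl (e : ℝ) (z : Fin q ⊕ Fin q ⊕ Fin p → ℝ) (i : Fin q) :
    (θ.companion e).mulVec z (.inl i) =
      if (i : ℕ) = 0 then (if 0 < e then 1 else 0) * (θ.coeffRow ⬝ᵥ z)
      else z (.inl ⟨i - 1, by omega⟩) := by
  by_cases h : (i : ℕ) = 0
  · simp [Matrix.mulVec, dotProduct, companion, h]
  · have h' : ∀ k : Fin q, (k : ℕ) + 1 = i ↔ k = ⟨i - 1, by omega⟩ := fun k => by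
      rw [Fin.ext_iff]; simp only; omega
    simp [Matrix.mulVec, dotProduct, companion, h, Fintype.sum_sum_type, h']

lemma companion_mulVec_inr_inl (e : ℝ) (z : Fin q ⊕ Fin q ⊕ Fin p → ℝ) (i : Fin q) :
    (θ.companion e).mulVec z (.inr (.inl i)) =
      if (i : ℕ) = 0 then (if e < 0 then 1 else 0) * (θ.coeffRow ⬝ᵥ z)
      else z (.inr (.inl ⟨i - 1, by omega⟩)) := by
  by_cases h : (i : ℕ) = 0
  · simp [Matrix.mulVec, dotProduct, companion, h]
  · have h' : ∀ k : Fin q, (k : ℕ) + 1 = i ↔ k = ⟨i - 1, by omega⟩ := fun k => by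
      rw [Fin.ext_iff]; simp only; omega
    simp [Matrix.mulVec, dotProduct, companion, h, Fintype.sum_sum_type, h']

lemma companion_mulVec_inr_inr (e : ℝ) (z : Fin q ⊕ Fin q ⊕ Fin p → ℝ) (j : Fin p) :
    (θ.companion e).mulVec z (.inr (.inr j)) =
      if (j : ℕ) = 0 then θ.coeffRow ⬝ᵥ z else z (.inr (.inr ⟨j - 1, by omega⟩)) := by
  by_cases h : (j : ℕ) = 0
  · simp [Matrix.mulVec, dotProduct, companion, h]
  · have h' : ∀ k : Fin p, (k : ℕ) + 1 = j ↔ k = ⟨j - 1, by omega⟩ := fun k => by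
      rw [Fin.ext_iff]; simp only; omega
    simp [Matrix.mulVec, dotProduct, companion, h, Fintype.sum_sum_type, h']

/-- Only the sign of `e` matters, so the matrix takes three values; this yields both its
measurability and its boundedness. -/
lemma companion_eq_ite (e : ℝ) : θ.companion e =
    if 0 < e then θ.companion 1 else if e < 0 then θ.companion (-1) else θ.companion 0 := by
  rcases lt_trichotomy e 0 with h | h | h
  · rw [if_neg h.not_gt, if_pos h]
    simp [companion, h, h.not_gt, (zero_lt_one' ℝ).not_gt]
  · simp [h]
  · rw [if_pos h]
    simp [companion, h, h.not_gt, (zero_lt_one' ℝ).not_gt]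

lemma measurable_companion_apply (i j : Fin q ⊕ Fin q ⊕ Fin p) :
    Measurable fun e => θ.companion e i j := by
  have : (fun e => θ.companion e i j) = fun e => if 0 < e then θ.companion 1 i j
      else if e < 0 then θ.companion (-1) i j else θ.companion 0 i j := by
    funext e
    rw [companion_eq_ite]
    split_ifs <;> rfl
  rw [this]
  exact Measurable.ite measurableSet_Ioi measurable_const
    (Measurable.ite measurableSet_Iio measurable_const measurable_const)

/-- The intercept of the volatility equation, `v` being the sequence of past noises. -/
noncomputable def intercept (v : ℕ → ℝ) : ℝ :=
  θ.omega + ∑ i : Fin q, θ.omegaNeg i * (if v i < 0 then 1 else 0)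

/-- The inhomogeneous term of the vector recurrence, `v` being the sequence of the present and
past noises. -/
noncomputable def innovation (v : ℕ → ℝ) : Fin q ⊕ Fin q ⊕ Fin p → ℝ
  | .inl i => if (i : ℕ) = 0 then
      (if 0 < v 0 then 1 else 0) * (θ.intercept (fun s => v (s + 1)) + Real.log (v 0 ^ 2)) else 0
  | .inr (.inl i) => if (i : ℕ) = 0 then
      (if v 0 < 0 then 1 else 0) * (θ.intercept (fun s => v (s + 1)) + Real.log (v 0 ^ 2)) else 0
  | .inr (.inr j) => if (j : ℕ) = 0 then θ.intercept (fun s => v (s + 1)) else 0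

lemma measurable_intercept : Measurable θ.intercept := by
  unfold intercept
  refine measurable_const.add (Finset.measurable_fun_sum _ fun i _ => measurable_const.mul ?_)
  exact Measurable.ite (measurableSet_lt (measurable_pi_apply _) measurable_const)
    measurable_const measurable_const

lemma measurable_innovation : Measurable θ.innovation := by
  have h1 : Measurable fun v : ℕ → ℝ => θ.intercept fun s => v (s + 1) :=
    θ.measurable_intercept.comp (measurable_pi_lambda _ fun s => measurable_pi_apply _)
  have h2 : Measurable fun v : ℕ → ℝ => Real.log (v 0 ^ 2) :=
    ((measurable_pi_apply 0).pow_const 2).log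
  have h3 : Measurable fun v : ℕ → ℝ => if 0 < v 0 then (1 : ℝ) else 0 :=
    Measurable.ite (measurableSet_lt measurable_const (measurable_pi_apply _))
      measurable_const measurable_const
  have h4 : Measurable fun v : ℕ → ℝ => if v 0 < 0 then (1 : ℝ) else 0 :=
    Measurable.ite (measurableSet_lt (measurable_pi_apply _) measurable_const)
      measurable_const measurable_const
  refine measurable_pi_lambda _ fun r => ?_
  rcases r with i | i | j
  · by_cases h : (i : ℕ) = 0
    · simp only [innovation, h, if_true]
      exact h3.mul (h1.add h2)
    · simpa only [innovation, h, if_false] using measurable_const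
  · by_cases h : (i : ℕ) = 0
    · simp only [innovation, h, if_true]
      exact h4.mul (h1.add h2)
    · simpa only [innovation, h, if_false] using measurable_const
  · by_cases h : (j : ℕ) = 0
    · simpa only [innovation, h, if_true] using h1
    · simpa only [innovation, h, if_false] using measurable_const

lemma abs_intercept_le (v : ℕ → ℝ) : |θ.intercept v| ≤ |θ.omega| + ∑ i, |θ.omegaNeg i| := by
  refine (abs_add_le _ _).trans (add_le_add le_rfl ((Finset.abs_sum_le_sum_abs _ _).trans
    (Finset.sum_le_sum fun i _ => ?_)))
  split_ifs <;> simp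

lemma norm_innovation_le (v : ℕ → ℝ) :
    ‖θ.innovation v‖ ≤ |θ.omega| + ∑ i, |θ.omegaNeg i| + |Real.log (v 0 ^ 2)| := by
  have hB := θ.abs_intercept_le fun s => v (s + 1)
  have hL := abs_nonneg (Real.log (v 0 ^ 2))
  have hI := abs_nonneg (θ.intercept fun s => v (s + 1))
  have hadd := abs_add_le (θ.intercept fun s => v (s + 1)) (Real.log (v 0 ^ 2))
  refine (pi_norm_le_iff_of_nonneg (by linarith)).2 fun r => ?_
  rw [Real.norm_eq_abs]
  rcases r with i | i | j <;> simp only [innovation] <;> split_ifs <;>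
    (try simp only [one_mul, zero_mul, abs_zero]) <;> linarith

/-- The state vector of the model: the last values of `1{ε > 0} log ε²`, of `1{ε < 0} log ε²` and
of `log σ²`. -/
noncomputable def stateVector (p q : ℕ) (ε σ : ℤ → ℝ) (t : ℤ) : Fin q ⊕ Fin q ⊕ Fin p → ℝ
  | .inl i => (if 0 < ε (t - i) then 1 else 0) * Real.log (ε (t - i) ^ 2)
  | .inr (.inl i) => (if ε (t - i) < 0 then 1 else 0) * Real.log (ε (t - i) ^ 2)
  | .inr (.inr j) => Real.log (σ (t - j) ^ 2)

section Path

variable {η ε σ : ℤ → ℝ}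

lemma pos_iff_of_eq_mul (hσ : ∀ t, 0 < σ t) (hε : ∀ t, ε t = σ t * η t) (t : ℤ) :
    0 < ε t ↔ 0 < η t := by
  rw [hε, mul_pos_iff_of_pos_left (hσ t)]

lemma neg_iff_of_eq_mul (hσ : ∀ t, 0 < σ t) (hε : ∀ t, ε t = σ t * η t) (t : ℤ) :
    ε t < 0 ↔ η t < 0 := by
  rw [hε]
  exact ⟨fun h => by
    by_contra! hc
    exact h.not_ge (mul_nonneg (hσ t).le hc), mul_neg_of_pos_of_neg (hσ t)⟩

lemma log_sq_of_eq_mul (hσ : ∀ t, 0 < σ t) (hε : ∀ t, ε t = σ t * η t) {t : ℤ} (hη : η t ≠ 0) :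
    Real.log (ε t ^ 2) = Real.log (σ t ^ 2) + Real.log (η t ^ 2) := by
  rw [hε, mul_pow, Real.log_mul (pow_ne_zero _ (hσ t).ne') (pow_ne_zero _ hη)]

/-- The signs of `ε` are those of `η`, so the asymmetry terms depend on the noise alone, and the
rest is linear in the previous state. -/
lemma volatility_rhs_eq (hσ : ∀ t, 0 < σ t) (hε : ∀ t, ε t = σ t * η t) (t : ℤ) :
    θ.omega
      + ∑ i : Fin q, θ.omegaNeg i * (if ε (t - (i + 1)) < 0 then 1 else 0)
      + ∑ j : Fin p, θ.beta j * Real.log (σ (t - (j + 1)) ^ 2)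
      + ∑ i : Fin q,
          (θ.alphaPos i * (if 0 < ε (t - (i + 1)) then 1 else 0)
            + θ.alphaNeg i * (if ε (t - (i + 1)) < 0 then 1 else 0))
          * Real.log (ε (t - (i + 1)) ^ 2)
      = θ.intercept (fun s : ℕ => η (t - 1 - s)) + θ.coeffRow ⬝ᵥ stateVector p q ε σ (t - 1) := by
  have hsub : ∀ s : ℤ, t - 1 - s = t - (s + 1) := fun s => by ring
  simp only [dotProduct, Fintype.sum_sum_type, coeffRow, Sum.elim_inl, Sum.elim_inr, stateVector,
    intercept, hsub, ← neg_iff_of_eq_mul hσ hε, add_mul, Finset.sum_add_distrib, mul_assoc]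
  ring

/-- Only the first row of each block has content: it is the volatility equation, combined in the two
`ε` blocks with `log ε² = log σ² + log η²` and a sign indicator. The other rows shift the lags. -/
lemma stateVector_recursion (hσ : ∀ t, 0 < σ t) (hε : ∀ t, ε t = σ t * η t) (hη : ∀ t, η t ≠ 0)
    (hlog : ∀ t, Real.log (σ t ^ 2) =
      θ.intercept (fun s : ℕ => η (t - 1 - s)) + θ.coeffRow ⬝ᵥ stateVector p q ε σ (t - 1))
    (t : ℤ) :
    stateVector p q ε σ t = (θ.companion (η t)).mulVec (stateVector p q ε σ (t - 1))
      + θ.innovation fun s : ℕ => η (t - s) := by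
  have hsub : ∀ s : ℕ, t - ((s + 1 : ℕ) : ℤ) = t - 1 - s := fun s => by push_cast; ring
  have hlag : ∀ n : ℕ, n ≠ 0 → t - 1 - ((n - 1 : ℕ) : ℤ) = t - n := fun n hn => by
    have : ((n - 1 : ℕ) : ℤ) = n - 1 := by omega
    rw [this]; ring
  have hlogε := log_sq_of_eq_mul hσ hε (hη t)
  funext r
  rw [Pi.add_apply]
  rcases r with i | i | j
  · rw [companion_mulVec_inl]
    by_cases h : (i : ℕ) = 0
    · simp only [innovation, stateVector, h, if_true, hsub, Nat.cast_zero, sub_zero, hlogε, hlog t,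
        pos_iff_of_eq_mul hσ hε]
      ring
    · simp only [innovation, stateVector, h, if_false, hlag i h, add_zero]
  · rw [companion_mulVec_inr_inl]
    by_cases h : (i : ℕ) = 0
    · simp only [innovation, stateVector, h, if_true, hsub, Nat.cast_zero, sub_zero, hlogε, hlog t,
        neg_iff_of_eq_mul hσ hε]
      ring
    · simp only [innovation, stateVector, h, if_false, hlag i h, add_zero]
  · rw [companion_mulVec_inr_inr]
    by_cases h : (j : ℕ) = 0
    · simp only [innovation, stateVector, h, if_true, hsub, Nat.cast_zero, sub_zero, hlog t]
      ring
    · simp only [innovation, stateVector, h, if_false, hlag j h, add_zero]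

/-- Converse direction, needed for existence: the first rows identify the entries of lag `0`, and
the shift rows reduce lag `n + 1` at time `t` to lag `n` at time `t - 1`. -/
lemma eq_stateVector_of_recursion {z : ℤ → Fin q ⊕ Fin q ⊕ Fin p → ℝ}
    (hz : ∀ t, z t = (θ.companion (η t)).mulVec (z (t - 1)) + θ.innovation fun s : ℕ => η (t - s))
    (hσ : ∀ t, 0 < σ t) (hε : ∀ t, ε t = σ t * η t) (hη : ∀ t, η t ≠ 0)
    (hlog : ∀ t, Real.log (σ t ^ 2) =
      θ.intercept (fun s : ℕ => η (t - 1 - s)) + θ.coeffRow ⬝ᵥ z (t - 1))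
    (t : ℤ) : z t = stateVector p q ε σ t := by
  have hsub : ∀ (t : ℤ) (s : ℕ), t - ((s + 1 : ℕ) : ℤ) = t - 1 - s := fun t s => by
    push_cast; ring
  have hz' : ∀ t r, z t r = (θ.companion (η t)).mulVec (z (t - 1)) r
      + θ.innovation (fun s : ℕ => η (t - s)) r := fun t r => by rw [← Pi.add_apply, ← hz]
  have h1 : ∀ (n : ℕ) (t : ℤ) (hn : n < q),
      z t (.inl ⟨n, hn⟩) = stateVector p q ε σ t (.inl ⟨n, hn⟩) := by
    intro n
    induction n with
    | zero =>
      intro t hn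
      rw [hz', companion_mulVec_inl]
      simp only [innovation, stateVector, if_true, hsub, Nat.cast_zero, sub_zero,
        log_sq_of_eq_mul hσ hε (hη t), hlog t, pos_iff_of_eq_mul hσ hε]
      ring
    | succ n ih =>
      intro t hn
      rw [hz', companion_mulVec_inl]
      simp only [innovation, Nat.succ_ne_zero, if_false, Nat.add_sub_cancel, add_zero]
      rw [ih (t - 1) (by omega)]
      simp only [stateVector, hsub]
  have h2 : ∀ (n : ℕ) (t : ℤ) (hn : n < q),
      z t (.inr (.inl ⟨n, hn⟩)) = stateVector p q ε σ t (.inr (.inl ⟨n, hn⟩)) := by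
    intro n
    induction n with
    | zero =>
      intro t hn
      rw [hz', companion_mulVec_inr_inl]
      simp only [innovation, stateVector, if_true, hsub, Nat.cast_zero, sub_zero,
        log_sq_of_eq_mul hσ hε (hη t), hlog t, neg_iff_of_eq_mul hσ hε]
      ring
    | succ n ih =>
      intro t hn
      rw [hz', companion_mulVec_inr_inl]
      simp only [innovation, Nat.succ_ne_zero, if_false, Nat.add_sub_cancel, add_zero]
      rw [ih (t - 1) (by omega)]
      simp only [stateVector, hsub]
  have h3 : ∀ (n : ℕ) (t : ℤ) (hn : n < p),
      z t (.inr (.inr ⟨n, hn⟩)) = stateVector p q ε σ t (.inr (.inr ⟨n, hn⟩)) := by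
    intro n
    induction n with
    | zero =>
      intro t hn
      rw [hz', companion_mulVec_inr_inr]
      simp only [innovation, stateVector, if_true, hsub, Nat.cast_zero, sub_zero, hlog t]
      ring
    | succ n ih =>
      intro t hn
      rw [hz', companion_mulVec_inr_inr]
      simp only [innovation, Nat.succ_ne_zero, if_false, Nat.add_sub_cancel, add_zero]
      rw [ih (t - 1) (by omega)]
      simp only [stateVector, hsub]
  funext r
  rcases r with i | i | j
  exacts [h1 i t i.2, h2 i t i.2, h3 j t j.2]

/-- Writing `log σ² = log ε² - log η²` removes `σ` from the bound, so that no stationarity of `σ` is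
needed later. -/
lemma norm_stateVector_le (hσ : ∀ t, 0 < σ t) (hε : ∀ t, ε t = σ t * η t) (hη : ∀ t, η t ≠ 0)
    (t : ℤ) :
    ‖stateVector p q ε σ t‖ ≤ ∑ i : Fin q, |Real.log (ε (t - i) ^ 2)|
      + ∑ j : Fin p, (|Real.log (ε (t - j) ^ 2)| + |Real.log (η (t - j) ^ 2)|) := by
  have h1 : ∀ i : Fin q, |Real.log (ε (t - i) ^ 2)| ≤ ∑ i : Fin q, |Real.log (ε (t - i) ^ 2)| :=
    fun i => Finset.single_le_sum (f := fun i : Fin q => |Real.log (ε (t - i) ^ 2)|)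
      (fun _ _ => abs_nonneg _) (Finset.mem_univ i)
  have h2 : ∀ j : Fin p, |Real.log (ε (t - j) ^ 2)| + |Real.log (η (t - j) ^ 2)| ≤
      ∑ j : Fin p, (|Real.log (ε (t - j) ^ 2)| + |Real.log (η (t - j) ^ 2)|) := fun j =>
    Finset.single_le_sum
      (f := fun j : Fin p => |Real.log (ε (t - j) ^ 2)| + |Real.log (η (t - j) ^ 2)|)
      (fun _ _ => add_nonneg (abs_nonneg _) (abs_nonneg _)) (Finset.mem_univ j)
  have h10 : 0 ≤ ∑ i : Fin q, |Real.log (ε (t - i) ^ 2)| :=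
    Finset.sum_nonneg fun _ _ => abs_nonneg _
  have h20 : 0 ≤ ∑ j : Fin p, (|Real.log (ε (t - j) ^ 2)| + |Real.log (η (t - j) ^ 2)|) :=
    Finset.sum_nonneg fun _ _ => add_nonneg (abs_nonneg _) (abs_nonneg _)
  refine (pi_norm_le_iff_of_nonneg (add_nonneg h10 h20)).2 fun r => ?_
  rw [Real.norm_eq_abs]
  rcases r with i | i | j
  · have := h1 i
    simp only [stateVector]
    split_ifs
    · rw [one_mul]; linarith
    · rw [zero_mul, abs_zero]; linarith
  · have := h1 i
    simp only [stateVector]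
    split_ifs
    · rw [one_mul]; linarith
    · rw [zero_mul, abs_zero]; linarith
  · have h := log_sq_of_eq_mul hσ hε (hη (t - j))
    have h' : Real.log (σ (t - j) ^ 2) = Real.log (ε (t - j) ^ 2) - Real.log (η (t - j) ^ 2) := by
      linarith
    simp only [stateVector, h']
    linarith [abs_sub (Real.log (ε (t - j) ^ 2)) (Real.log (η (t - j) ^ 2)), h2 j]

end Path

end ASLogGarch

/-! ### The stationary volatility. -/

namespace ASLogGarch

variable {p q : ℕ} (θ : ASLogGarch p q) {Ω : Type*} [MeasurableSpace Ω] {P : Measure Ω}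

/-- The stationary volatility as a function of the past noises. -/
noncomputable def stationaryVolatility (v : ℕ → ℝ) : ℝ :=
  Real.exp ((θ.intercept v + θ.coeffRow ⬝ᵥ recurrenceSolution θ.companion θ.innovation v) / 2)

lemma measurable_stationaryVolatility : Measurable θ.stationaryVolatility := by
  have hz := measurable_recurrenceSolution θ.measurable_companion_apply θ.measurable_innovation
  refine Real.measurable_exp.comp (Measurable.div_const (θ.measurable_intercept.add ?_) 2)
  exact Finset.measurable_fun_sum _ fun r _ =>
    measurable_const.mul ((measurable_pi_apply r).comp hz)

lemma log_stationaryVolatility_sq (v : ℕ → ℝ) : Real.log (θ.stationaryVolatility v ^ 2) =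
    θ.intercept v + θ.coeffRow ⬝ᵥ recurrenceSolution θ.companion θ.innovation v := by
  rw [Real.log_pow, stationaryVolatility, Real.log_exp]
  push_cast
  ring

attribute [local instance] Matrix.linftyOpNormedAddCommGroup in
lemma exists_norm_companion_le : ∃ K : ℝ, ∀ e, ‖θ.companion e‖ ≤ K := by
  refine ⟨‖θ.companion 1‖ + ‖θ.companion (-1)‖ + ‖θ.companion 0‖, fun e => ?_⟩
  have h1 := norm_nonneg (θ.companion 1)
  have h2 := norm_nonneg (θ.companion (-1))
  have h3 := norm_nonneg (θ.companion 0)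
  rw [companion_eq_ite]
  split_ifs <;> linarith

end ASLogGarch

/-! ### Uniqueness and existence of the stationary solution. -/

section

variable {p q : ℕ} {θ : ASLogGarch p q} {Ω : Type*} [MeasurableSpace Ω] {P : Measure Ω}
  {η ε σ ε' σ' : ℤ → Ω → ℝ}

lemma IsIIDNoise.ae_ne_zero (hη : IsIIDNoise P η) (hη_ne : ∀ᵐ x ∂P, η 0 x ≠ 0) :
    ∀ᵐ x ∂P, ∀ t, η t x ≠ 0 :=
  ae_all_iff.2 fun t => (hη.identDistrib t).symm.ae_snd (p := fun y => y ≠ 0)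
    (measurableSet_singleton 0).compl hη_ne

/-- The model in vector form, pathwise. -/
lemma ASLogGarch.IsSolution.ae_log_sigma_eq (h : θ.IsSolution P η ε σ) :
    ∀ᵐ x ∂P, ∀ t : ℤ, Real.log (σ t x ^ 2) = θ.intercept (fun s : ℕ => η (t - 1 - s) x)
      + θ.coeffRow ⬝ᵥ ASLogGarch.stateVector p q (ε · x) (σ · x) (t - 1) := by
  filter_upwards [h.sigma_pos, h.eps_eq, h.log_sigma_eq] with x hσ hε hlog t
  rw [hlog t]
  exact θ.volatility_rhs_eq (η := (η · x)) (ε := (ε · x)) (σ := (σ · x)) hσ hε t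

/-- The bound on the state involves only one-dimensional marginals of `ε` and `η`, and these do not
depend on time. -/
lemma ASLogGarch.IsSolution.boundedAboveInProbability_stateVector [IsProbabilityMeasure P]
    (h : θ.IsSolution P η ε σ) (hη : IsIIDNoise P η) (hη_ne : ∀ᵐ x ∂P, η 0 x ≠ 0)
    (hε : StrictlyStationary P ε) :
    BoundedAboveInProbability P
      (fun t x => ‖ASLogGarch.stateVector p q (ε · x) (σ · x) t‖) := by
  have hm : Measurable fun y : ℝ => |Real.log (y ^ 2)| := by
    simpa only [Real.norm_eq_abs, id_eq] using (measurable_id.pow_const 2).log.norm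
  have hbε : BoundedAboveInProbability P (fun t x => |Real.log (ε t x ^ 2)|) := by
    refine .of_identDistrib fun t => ?_
    have := (hε t).comp (hm.comp (measurable_pi_apply (0 : ℤ)))
    simpa [Function.comp_def] using this
  have hbη : BoundedAboveInProbability P (fun t x => |Real.log (η t x ^ 2)|) :=
    .of_identDistrib fun t => (hη.identDistrib t).comp hm
  refine ((BoundedAboveInProbability.sum Finset.univ fun (i : Fin q) _ =>
    hbε.comp fun t => t - i).add (BoundedAboveInProbability.sum Finset.univ fun (j : Fin p) _ =>
      (hbε.comp fun t => t - j).add (hbη.comp fun t => t - j))).mono fun t => ?_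
  filter_upwards [h.sigma_pos, h.eps_eq, hη.ae_ne_zero hη_ne] with x hσ hεx hηx
  exact ASLogGarch.norm_stateVector_le (η := (η · x)) (ε := (ε · x)) (σ := (σ · x)) hσ hεx hηx t

/-- The innovations cancel in the difference of the state vectors, leaving the homogeneous
recurrence. Each state is bounded in probability, hence so is the difference: joint stationarity of
the two solutions is not required. -/
theorem ASLogGarch.IsSolution.unique [IsProbabilityMeasure P] (hη : IsIIDNoise P η)
    (hη_ne : ∀ᵐ x ∂P, η 0 x ≠ 0)
    (hγ : topLyapunov P (fun t x => θ.companion (η t x)) < 0)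
    (h : θ.IsSolution P η ε σ) (hst : StrictlyStationary P ε)
    (h' : θ.IsSolution P η ε' σ') (hst' : StrictlyStationary P ε') :
    ∀ᵐ x ∂P, ∀ t, ε t x = ε' t x ∧ σ t x = σ' t x := by
  obtain ⟨K, hK⟩ := θ.exists_norm_companion_le
  set Z := fun t x => ASLogGarch.stateVector p q (ε · x) (σ · x) t
  set Z' := fun t x => ASLogGarch.stateVector p q (ε' · x) (σ' · x) t
  have hD : ∀ᵐ x ∂P, ∀ t, Z t x - Z' t x =
      (θ.companion (η t x)).mulVec (Z (t - 1) x - Z' (t - 1) x) := by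
    filter_upwards [h.sigma_pos, h.eps_eq, h'.sigma_pos, h'.eps_eq, hη.ae_ne_zero hη_ne,
      h.ae_log_sigma_eq, h'.ae_log_sigma_eq] with x hσ hε hσ' hε' hηx hlog hlog' t
    have e := θ.stateVector_recursion (η := (η · x)) (ε := (ε · x)) (σ := (σ · x)) hσ hε hηx hlog t
    have e' := θ.stateVector_recursion (η := (η · x)) (ε := (ε' · x)) (σ := (σ' · x))
      hσ' hε' hηx hlog' t
    simp only [Z, Z']
    rw [e, e', Matrix.mulVec_sub]
    abel
  have hbdd : BoundedAboveInProbability P (fun t x => ‖Z t x - Z' t x‖) :=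
    ((h.boundedAboveInProbability_stateVector hη hη_ne hst).add
      (h'.boundedAboveInProbability_stateVector hη hη_ne hst')).mono
      fun t => ae_of_all _ fun x => norm_sub_le _ _
  have hzero := ae_all_iff.2 fun t =>
    hη.homogeneous_recurrence_eq_zero θ.measurable_companion_apply hK hγ hD hbdd t
  filter_upwards [h.sigma_pos, h.eps_eq, h'.sigma_pos, h'.eps_eq, h.ae_log_sigma_eq,
    h'.ae_log_sigma_eq, hzero] with x hσ hε hσ' hε' hlog hlog' hz t
  have hZ : ASLogGarch.stateVector p q (ε · x) (σ · x) (t - 1)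
      = ASLogGarch.stateVector p q (ε' · x) (σ' · x) (t - 1) := sub_eq_zero.1 (hz (t - 1))
  have hlogσ : Real.log (σ t x ^ 2) = Real.log (σ' t x ^ 2) := by rw [hlog t, hlog' t, hZ]
  have hσσ : σ t x = σ' t x := by
    rw [Real.log_pow, Real.log_pow] at hlogσ
    exact Real.log_injOn_pos (hσ t) (hσ' t) (mul_left_cancel₀ (by norm_num) hlogσ)
  exact ⟨by rw [hε t, hε' t, hσσ], hσσ⟩

theorem ASLogGarch.isSolution_stationaryVolatility [IsProbabilityMeasure P] (hη : IsIIDNoise P η)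
    (hη_ne : ∀ᵐ x ∂P, η 0 x ≠ 0)
    (hη_log : Integrable (fun x => Real.posLog |Real.log (η 0 x ^ 2)|) P)
    (hγ : topLyapunov P (fun t x => θ.companion (η t x)) < 0) :
    θ.IsSolution P η
      (fun t x => θ.stationaryVolatility (fun s : ℕ => η (t - 1 - s) x) * η t x)
      (fun t x => θ.stationaryVolatility fun s : ℕ => η (t - 1 - s) x) := by
  have hσm : ∀ t : ℤ, Measurable fun x =>
      θ.stationaryVolatility fun s : ℕ => η (t - 1 - s) x := fun t =>
    θ.measurable_stationaryVolatility.comp (measurable_pi_lambda _ fun s => hη.measurable _)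
  refine ⟨fun t => (hσm t).mul (hη.measurable t), hσm,
    ae_of_all _ fun x t => Real.exp_pos _, ae_of_all _ fun x t => rfl, ?_⟩
  obtain ⟨K, hK⟩ := θ.exists_norm_companion_le
  filter_upwards [hη.recurrenceSolution_recursion hη_log θ.measurable_companion_apply hK hγ
    θ.norm_innovation_le, hη.ae_ne_zero hη_ne] with x hz hηx t
  set σ₀ : ℤ → ℝ := fun t => θ.stationaryVolatility fun s : ℕ => η (t - 1 - s) x
  have hσ : ∀ t, 0 < σ₀ t := fun t => Real.exp_pos _
  have hε : ∀ t, (fun t => σ₀ t * η t x) t = σ₀ t * (η · x) t := fun t => rfl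
  have hlog : ∀ t, Real.log (σ₀ t ^ 2) = _ := fun t => θ.log_stationaryVolatility_sq _
  -- The volatility was defined through the series; identifying the series with the state vector
  -- turns that definition into the model equation.
  have hst := θ.eq_stateVector_of_recursion (η := (η · x)) hz hσ hε hηx hlog (t - 1)
  exact (hlog t).trans ((congrArg _ (congrArg _ hst)).trans
    (θ.volatility_rhs_eq (η := (η · x)) hσ hε t).symm)

end

theorem theorem1 {p q : ℕ} (θ : ASLogGarch p q)
    {Ω : Type*} [MeasurableSpace Ω] (P : Measure Ω) [IsProbabilityMeasure P]
    (η : ℤ → Ω → ℝ) (hη : IsIIDNoise P η)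
    -- `E log⁺ |log η_0²| < ∞`, where `log 0 = -∞`: hence the first condition
    (hη_ne : ∀ᵐ x ∂P, η 0 x ≠ 0)
    (hη_log : Integrable (fun x => Real.posLog |Real.log (η 0 x ^ 2)|) P)
    (hγ : topLyapunov P (fun t x => θ.companion (η t x)) < 0) :
    -- existence of a strictly stationary solution
    (∃ ε σ : ℤ → Ω → ℝ, θ.IsSolution P η ε σ ∧
      StrictlyStationary P (fun t x => (ε t x, σ t x))) ∧
    -- uniqueness of the stationary solution
    (∀ ε σ ε' σ' : ℤ → Ω → ℝ,
      θ.IsSolution P η ε σ → StrictlyStationary P ε →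
      θ.IsSolution P η ε' σ' → StrictlyStationary P ε' →
      ∀ t, ε t =ᵐ[P] ε' t ∧ σ t =ᵐ[P] σ' t) ∧
    -- the stationary solution is non-anticipative and ergodic
    (∀ ε σ : ℤ → Ω → ℝ,
      θ.IsSolution P η ε σ → StrictlyStationary P ε →
      NonAnticipative P η ε ∧
      NonAnticipative P η (fun t => σ (t + 1)) ∧
      ErgodicProcess P (fun t x => (ε t x, σ t x))) := by
  set S := θ.stationaryVolatility
  have hS : Measurable S := θ.measurable_stationaryVolatility
  set σ₀ : ℤ → Ω → ℝ := fun t x => S fun s : ℕ => η (t - 1 - s) x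
  set ε₀ : ℤ → Ω → ℝ := fun t x => σ₀ t x * η t x
  have hsol : θ.IsSolution P η ε₀ σ₀ :=
    ASLogGarch.isSolution_stationaryVolatility hη hη_ne hη_log hγ
  -- The pair at time `t` as a function of the noise recentred at `t`; the volatility reads only
  -- strictly negative indices.
  let ψ : (ℤ → ℝ) → ℝ × ℝ := fun u => (S (fun s : ℕ => u (-1 - s)) * u 0, S fun s => u (-1 - s))
  have hψS : Measurable fun u : ℤ → ℝ => S fun s : ℕ => u (-1 - s) :=
    hS.comp (measurable_pi_lambda _ fun s => measurable_pi_apply _)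
  have hψ : Measurable ψ := (hψS.mul (measurable_pi_apply 0)).prodMk hψS
  have hfac : (fun t x => (ε₀ t x, σ₀ t x)) = fun (t : ℤ) x => ψ fun s => η (t + s) x := by
    funext t x
    have hs : ∀ s : ℕ, t - 1 - (s : ℤ) = t + (-1 - s) := fun s => by ring
    simp only [ε₀, σ₀, ψ, hs, add_zero]
  have hstat : StrictlyStationary P (fun t x => (ε₀ t x, σ₀ t x)) := by
    rw [hfac]; exact hη.strictlyStationary_factor hψ
  have hstatε : StrictlyStationary P ε₀ := fun h =>
    (hstat h).comp (u := fun (y : ℤ → ℝ × ℝ) t => (y t).1)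
      (measurable_pi_lambda _ fun t => (measurable_pi_apply t).fst)
  refine ⟨⟨ε₀, σ₀, hsol, hstat⟩, ?_, ?_⟩
  · intro ε σ ε' σ' h hst h' hst' t
    have hu := ASLogGarch.IsSolution.unique hη hη_ne hγ h hst h' hst'
    exact ⟨hu.mono fun x hx => (hx t).1, hu.mono fun x hx => (hx t).2⟩
  · intro ε σ h hst
    -- Any stationary solution coincides with the constructed one, so everything is checked on the
    -- latter.
    have hu := ASLogGarch.IsSolution.unique hη hη_ne hγ h hst hsol hstatε
    -- Here `w 0` is `η_t`, while the volatility at time `t` starts at `η_{t-1}`, hence `w (s + 1)`.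
    -- For `σ (t + 1)` the past starts at `η_t`, so `S` itself is the witness.
    refine ⟨fun t => ⟨fun w => S (fun s => w (s + 1)) * w 0, ?_, ?_⟩, fun t => ⟨S, hS, ?_⟩, ?_⟩
    · exact (hS.comp (measurable_pi_lambda _ fun s => measurable_pi_apply _)).mul
        (measurable_pi_apply 0)
    · filter_upwards [hu] with x hx
      have hs : ∀ s : ℕ, t - ((s + 1 : ℕ) : ℤ) = t - 1 - s := fun s => by push_cast; ring
      rw [(hx t).1]
      simp only [hs, Nat.cast_zero, sub_zero]
      rfl
    · filter_upwards [hu] with x hx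
      rw [(hx (t + 1)).2]
      simp only [σ₀, add_sub_cancel_right]
    · have hmap : P.map (fun x t => (ε t x, σ t x)) = P.map (fun x t => (ε₀ t x, σ₀ t x)) :=
        Measure.map_congr (hu.mono fun x hx => by
          funext t
          exact Prod.ext (hx t).1 (hx t).2)
      have herg : ErgodicProcess P (fun t x => (ε₀ t x, σ₀ t x)) := by
        rw [hfac]; exact hη.ergodicProcess_factor hψ
      unfold ErgodicProcess at herg ⊢
      rwa [hmap]
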